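/- Let $n\ge 0$ and let $X,Y\in\mathbb{Z}^{n\times n}$ be two matrices with the same minimal polynomial (over $\mathbb{Q}$) $\mu_X=\mu_Y=\prod_{i=1}^k(t-a_i)$, where $a_1,\dots,a_k\in\mathbb{Z}$ are pairwise distinct. By the Chinese Remainder Theorem, $\mathbb{Q}[X]\cong\bigoplus_{i=1}^k\mathbb{Q}[t]/(t-a_i)\cong\mathbb{Q}^k$. Let $e_1,\dots,e_k\in\mathbb{Q}[X]\subseteq\mathbb{Q}^{n\times n}$ be the primitive idempotents of this algebra, with $e_i$ corresponding to the factor $\mathbb{Q}[t]/(t-a_i)$. For each $i$ let $q_i$ be the least positive integer such that $E_i:=q_ie_i\in\mathbb{Z}^{n\times n}$. For $A\in\mathbb{Z}^{n\times n}$, the Smith group of $A$ is the torsion subgroup of the cokernel of the endomorphism $A$ of $\mathbb{Z}^n$. Assume that one of the following two statements holds: (a) for all $1\le i\le k$ the Smith group of $E_i$ has exponent $q_i$; (b) $k\ge 1$, $\operatorname{rk}(e_1)=1$, and for all $2\le i\le k$ the Smith group of $E_i$ has exponent $q_i$. For a prime $p$ let $\mathbb{Z}_{(p)}=\{a/b\in\mathbb{Q}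 : a,b\in\mathbb{Z},\ p\nmid b\}$. Then there is some $T\in\mathrm{GL}_n(\mathbb{Z})$ with $TXT^{-1}=Y$ if and only if for every prime $p$ there is a matrix $T_p\in\mathrm{GL}_n(\mathbb{Z}_{(p)})$ with $T_pXT_p^{-1}=Y$. -/

import Mathlib

open Polynomial

/-- The localization `ℤ_(p) = {a / b ∈ ℚ | p ∤ b}` of `ℤ` at the prime `p`, a subring of `ℚ`. -/
def zLocal (p : ℕ) [hp : Fact p.Prime] : Subring ℚ where
  carrier := {x | ∃ a b : ℤ, ¬ (p : ℤ) ∣ b ∧ x = (a : ℚ) / (b : ℚ)}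
  one_mem' := ⟨1, 1, (Nat.prime_iff_prime_int.mp hp.out).not_dvd_one, by simp⟩
  zero_mem' := ⟨0, 1, (Nat.prime_iff_prime_int.mp hp.out).not_dvd_one, by simp⟩
  neg_mem' := by
    rintro _ ⟨a, b, hb, rfl⟩
    exact ⟨-a, b, hb, by push_cast; ring⟩
  mul_mem' := by
    rintro _ _ ⟨a, b, hb, rfl⟩ ⟨c, d, hd, rfl⟩
    refine ⟨a * c, b * d, fun h => ?_, by push_cast; rw [div_mul_div_comm]⟩
    exact ((Nat.prime_iff_prime_int.mp hp.out).dvd_or_dvd h).elim hb hd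
  add_mem' := by
    rintro _ _ ⟨a, b, hb, rfl⟩ ⟨c, d, hd, rfl⟩
    refine ⟨a * d + b * c, b * d, fun h => ?_, ?_⟩
    · exact ((Nat.prime_iff_prime_int.mp hp.out).dvd_or_dvd h).elim hb hd
    · have hb0 : (b : ℚ) ≠ 0 := by
        rintro h0
        exact hb (by rw [Int.cast_eq_zero.mp h0]; exact dvd_zero _)
      have hd0 : (d : ℚ) ≠ 0 := by
        rintro h0
        exact hd (by rw [Int.cast_eq_zero.mp h0]; exact dvd_zero _)
      push_cast
      rw [div_add_div _ _ hb0 hd0]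

/-- The integral matrices `X` and `Y` are conjugate in `GL_n(R)`. -/
def ConjugateOver (R : Type*) [CommRing R] {n : ℕ} (X Y : Matrix (Fin n) (Fin n) ℤ) : Prop :=
  ∃ T : GL (Fin n) R,
    (T : Matrix (Fin n) (Fin n) R) * X.map (Int.cast : ℤ → R) *
      ((T⁻¹ : GL (Fin n) R) : Matrix (Fin n) (Fin n) R) = Y.map (Int.cast : ℤ → R)

/-- The integral matrix `X`, seen as a rational matrix. -/
def ratMatrix {n : ℕ} (X : Matrix (Fin n) (Fin n) ℤ) : Matrix (Fin n) (Fin n) ℚ :=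
  X.map (Int.cast : ℤ → ℚ)

/-- The Smith group of an integral matrix `A`: the torsion subgroup of the cokernel of the
endomorphism of `ℤ^n` given by `A`. -/
abbrev SmithGroup {n : ℕ} (A : Matrix (Fin n) (Fin n) ℤ) : Type :=
  Submodule.torsion ℤ ((Fin n → ℤ) ⧸ LinearMap.range A.mulVecLin)

/-- The element `e_i` of `ℚ[X]` that corresponds, under the Chinese remainder isomorphism
`ℚ[X] ≅ ⨁ j, ℚ[t]/(t - a_j)`, to the `i`-th standard idempotent: it is `f(X)` for the polynomial
`f` of degree less than `k` with `f(a_i) = 1` and `f(a_j) = 0` for `j ≠ i`. If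
`∏ j, (t - a_j)` is the minimal polynomial of `X`, with distinct `a_j`, then
`e_1, …, e_k` are precisely the primitive idempotents of `ℚ[X]`
(see `isPrimitiveIdempotentIn_iff`). -/
noncomputable def primIdem {n k : ℕ} (X : Matrix (Fin n) (Fin n) ℤ) (a : Fin k → ℤ) (i : Fin k) :
    Matrix (Fin n) (Fin n) ℚ :=
  aeval (ratMatrix X) (Lagrange.basis Finset.univ (fun j => (a j : ℚ)) i)

/-- The least positive integer `q_i` such that `q_i e_i` is an integral matrix. -/
noncomputable def primDen {n k : ℕ} (X : Matrix (Fin n) (Fin n) ℤ) (a : Fin k → ℤ) (i : Fin k) :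
    ℕ :=
  (primIdem X a i).den

/-- The integral matrix `E_i = q_i e_i`. -/
noncomputable def primNum {n k : ℕ} (X : Matrix (Fin n) (Fin n) ℤ) (a : Fin k → ℤ) (i : Fin k) :
    Matrix (Fin n) (Fin n) ℤ :=
  (primIdem X a i).num

/-- The Smith group of `E_i` has exponent `q_i`. -/
def SmithExponentCondition {n k : ℕ} (X : Matrix (Fin n) (Fin n) ℤ) (a : Fin k → ℤ)
    (i : Fin k) : Prop :=
  AddMonoid.exponent (SmithGroup (primNum X a i)) = primDen X a i

/-- The assumption on `X`: either (a) the Smith group of every `E_i` has exponent `q_i`, or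
(b) the first idempotent `e_1` has rank one and the Smith group of every other `E_i` has
exponent `q_i`. -/
def SmithAssumption {n k : ℕ} (X : Matrix (Fin n) (Fin n) ℤ) (a : Fin k → ℤ) : Prop :=
  (∀ i, SmithExponentCondition X a i) ∨
  (∃ h : 0 < k, (primIdem X a ⟨0, h⟩).rank = 1 ∧
    ∀ i, i ≠ ⟨0, h⟩ → SmithExponentCondition X a i)

/-- `f` is a primitive idempotent of the commutative subalgebra `A`: a nonzero idempotent of `A`
that bounds no idempotents of `A` other than `0` and itself. -/
def IsPrimitiveIdempotentIn {R : Type*} [Ring R] [Algebra ℚ R] (A : Subalgebra ℚ R) (f : R) :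
    Prop :=
  f ∈ A ∧ IsIdempotentElem f ∧ f ≠ 0 ∧
    ∀ g ∈ A, IsIdempotentElem g → g * f = g → g = 0 ∨ g = f

theorem ratMatrix_primNum {n k : ℕ} (X : Matrix (Fin n) (Fin n) ℤ) (a : Fin k → ℤ) (i : Fin k) :
    ratMatrix (primNum X a i) = (primDen X a i : ℚ) • primIdem X a i := by
  have h := (primIdem X a i).inv_denom_smul_num
  have h0 : ((primIdem X a i).den : ℚ) ≠ 0 := Nat.cast_ne_zero.mpr (Matrix.den_ne_zero _)
  unfold ratMatrix primNum primDen
  exact (inv_smul_eq_iff₀ h0).mp h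

theorem isLeast_primDen {n k : ℕ} (X : Matrix (Fin n) (Fin n) ℤ) (a : Fin k → ℤ) (i : Fin k) :
    IsLeast {q : ℕ | 0 < q ∧ ∃ E : Matrix (Fin n) (Fin n) ℤ,
      ratMatrix E = (q : ℚ) • primIdem X a i} (primDen X a i) := by
  refine ⟨⟨Nat.pos_of_ne_zero (Matrix.den_ne_zero _), _, ratMatrix_primNum X a i⟩, ?_⟩
  rintro q ⟨hq, E, hE⟩
  refine Nat.le_of_dvd hq (Matrix.den_dvd_iff.mpr fun r s => ?_)
  have h : ((E r s : ℤ) : ℚ) = (q : ℚ) * primIdem X a i r s := congrFun (congrFun hE r) s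
  have hq0 : (q : ℚ) ≠ 0 := by positivity
  have h2 : primIdem X a i r s = Rat.divInt (E r s) (q : ℤ) := by
    rw [Rat.divInt_eq_div, h]
    push_cast
    field_simp
  rw [h2]
  exact_mod_cast Rat.den_dvd (E r s) (q : ℤ)

theorem primIdem_mul_aeval {n k : ℕ} {X : Matrix (Fin n) (Fin n) ℤ} {a : Fin k → ℤ}
    (ha : Function.Injective a) (hX : minpoly ℚ (ratMatrix X) = ∏ i, (Polynomial.X - C (a i : ℚ)))
    (i : Fin k) (f : ℚ[X]) :
    primIdem X a i * aeval (ratMatrix X) f = f.eval (a i : ℚ) • primIdem X a i := by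
  have ha' : Function.Injective (fun j => (a j : ℚ)) := Int.cast_injective.comp ha
  have hdvd : minpoly ℚ (ratMatrix X) ∣
      Lagrange.basis Finset.univ (fun j => (a j : ℚ)) i * (f - C (f.eval (a i : ℚ))) := by
    rw [hX]
    refine Fintype.prod_dvd_of_coprime (pairwise_coprime_X_sub_C ha') fun j => ?_
    rw [dvd_iff_isRoot, IsRoot, eval_mul]
    rcases eq_or_ne i j with rfl | hij
    · simp
    · rw [Lagrange.eval_basis_of_ne (v := fun j => (a j : ℚ)) hij (Finset.mem_univ j), zero_mul]
  have h := (minpoly.dvd_iff).mp hdvd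
  rw [map_mul, map_sub, aeval_C, mul_sub, sub_eq_zero] at h
  rw [primIdem, h, Algebra.algebraMap_eq_smul_one, mul_smul_comm, mul_one]

theorem primIdem_ne_zero {n k : ℕ} {X : Matrix (Fin n) (Fin n) ℤ} {a : Fin k → ℤ}
    (ha : Function.Injective a) (hX : minpoly ℚ (ratMatrix X) = ∏ i, (Polynomial.X - C (a i : ℚ)))
    (i : Fin k) : primIdem X a i ≠ 0 := by
  have ha' : Function.Injective (fun j => (a j : ℚ)) := Int.cast_injective.comp ha
  intro h
  have hdvd := (minpoly.dvd_iff).mpr h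
  rw [hX] at hdvd
  have h2 := (Finset.dvd_prod_of_mem (fun i => (Polynomial.X - C (a i : ℚ))) (Finset.mem_univ i)).trans hdvd
  rw [dvd_iff_isRoot, IsRoot,
    Lagrange.eval_basis_self (v := fun j => (a j : ℚ)) ha'.injOn (Finset.mem_univ i)] at h2
  exact one_ne_zero h2

theorem eq_sum_primIdem {n k : ℕ} {X : Matrix (Fin n) (Fin n) ℤ} {a : Fin k → ℤ}
    (ha : Function.Injective a) (hX : minpoly ℚ (ratMatrix X) = ∏ i, (Polynomial.X - C (a i : ℚ)))
    (f : ℚ[X]) :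
    aeval (ratMatrix X) f = ∑ i, f.eval (a i : ℚ) • primIdem X a i := by
  have ha' : Function.Injective (fun j => (a j : ℚ)) := Int.cast_injective.comp ha
  have h1 : ∑ i, primIdem X a i = 1 := by
    rcases Nat.eq_zero_or_pos k with rfl | hk
    · have h := minpoly.aeval ℚ (ratMatrix X)
      rw [hX] at h
      simpa using h.symm
    · have : Nonempty (Fin k) := ⟨⟨0, hk⟩⟩
      simp only [primIdem]
      rw [← map_sum, Lagrange.sum_basis ha'.injOn Finset.univ_nonempty, map_one]
  calc aeval (ratMatrix X) f = (∑ i, primIdem X a i) * aeval (ratMatrix X) f := by rw [h1, one_mul]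
    _ = _ := by
      rw [Finset.sum_mul]
      exact Finset.sum_congr rfl fun i _ => primIdem_mul_aeval ha hX i f

/-- The matrices `e_1, …, e_k` are exactly the primitive idempotents of `ℚ[X]`. -/
theorem isPrimitiveIdempotentIn_iff {n k : ℕ} {X : Matrix (Fin n) (Fin n) ℤ} {a : Fin k → ℤ}
    (ha : Function.Injective a) (hX : minpoly ℚ (ratMatrix X) = ∏ i, (Polynomial.X - C (a i : ℚ)))
    (f : Matrix (Fin n) (Fin n) ℚ) :
    IsPrimitiveIdempotentIn (Algebra.adjoin ℚ {ratMatrix X}) f ↔ ∃ i, primIdem X a i = f := by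
  have ha' : Function.Injective (fun j => (a j : ℚ)) := Int.cast_injective.comp ha
  have hmem : ∀ g ∈ Algebra.adjoin ℚ {ratMatrix X}, ∃ p : ℚ[X], aeval (ratMatrix X) p = g := by
    intro g hg
    rw [Algebra.adjoin_singleton_eq_range_aeval] at hg
    exact hg
  have hadj : ∀ i, primIdem X a i ∈ Algebra.adjoin ℚ {ratMatrix X} := fun i =>
    aeval_mem_adjoin_singleton ℚ _
  have hidem : ∀ i, IsIdempotentElem (primIdem X a i) := by
    intro i
    have h := primIdem_mul_aeval ha hX i (Lagrange.basis Finset.univ (fun j => (a j : ℚ)) i)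
    rw [Lagrange.eval_basis_self (v := fun j => (a j : ℚ)) ha'.injOn (Finset.mem_univ i),
      one_smul] at h
    exact h
  have hval : ∀ (p : ℚ[X]), IsIdempotentElem (aeval (ratMatrix X) p) → ∀ i : Fin k,
      p.eval (a i : ℚ) = 0 ∨ p.eval (a i : ℚ) = 1 := by
    intro p hp i
    have h1 := primIdem_mul_aeval ha hX i (p * p)
    rw [map_mul, hp.eq, primIdem_mul_aeval ha hX i p, eval_mul] at h1
    have h2 := smul_left_injective ℚ (primIdem_ne_zero ha hX i) h1
    by_cases h0 : p.eval (a i : ℚ) = 0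
    · exact Or.inl h0
    · exact Or.inr (mul_left_cancel₀ h0 (by rw [mul_one]; exact h2.symm))
  constructor
  · rintro ⟨hf, hfi, hf0, hmin⟩
    obtain ⟨p, rfl⟩ := hmem f hf
    have hex : ∃ i : Fin k, p.eval (a i : ℚ) ≠ 0 := by
      by_contra! h
      apply hf0
      rw [eq_sum_primIdem ha hX p]
      exact Finset.sum_eq_zero fun i _ => by rw [h i, zero_smul]
    obtain ⟨i, hi⟩ := hex
    refine ⟨i, ?_⟩
    have h1 := (hval p hfi i).resolve_left hi
    refine (hmin _ (hadj i) (hidem i) ?_).resolve_left (primIdem_ne_zero ha hX i)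
    rw [primIdem_mul_aeval ha hX i p, h1, one_smul]
  · rintro ⟨i, rfl⟩
    refine ⟨hadj i, hidem i, primIdem_ne_zero ha hX i, ?_⟩
    intro g hg hgi hge
    obtain ⟨p, rfl⟩ := hmem g hg
    have hcomm : aeval (ratMatrix X) p * primIdem X a i
        = primIdem X a i * aeval (ratMatrix X) p := by
      rw [primIdem, ← map_mul, ← map_mul, mul_comm]
    rw [hcomm, primIdem_mul_aeval ha hX i p] at hge
    rcases hval p hgi i with h | h
    · left
      rw [← hge, h, zero_smul]
    · right
      rw [← hge, h, one_smul]

/-! Write L_i(X) for the a_i-eigenlattice of X in ℤ^n, and let N > 1 be a common multiple of the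
denominators of the primitive idempotents of X and Y. Then N·ℤ^n lies in the direct sum of the
L_i(X), and likewise for Y.

Combining the local conjugations by the Chinese remainder theorem gives an integral intertwiner T
with det T prime to N (`exists_intertwiner_isCoprime_det`). It induces maps L_i(X) → L_i(Y) whose
determinants, relative to arbitrary isomorphisms θ_i : L_i(Y) ≃ L_i(X), are units modulo N².

These determinants can be normalised to 1 modulo N² by composing T with matrices that commute with
X. If the Smith group of E_i has exponent q_i, then L_i(X) contains v and there is a left
eigenvector φ with φ(v) = 1 (`exists_rank_one_summand`). The matrix 1 + (u - 1)vφ commutes with X,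
has determinant u on L_i(X) and is the identity on the other eigenlattices. In case (b) a scalar
matrix handles the eigenlattice of rank one.

Since SL_m(ℤ) → SL_m(ℤ/N²) is surjective (`exists_unit_map_eq`), each normalised map is congruent
modulo N² to an isomorphism. The difference on the eigenlattices extends to an intertwiner of ℤ^n
that is still divisible by N. Subtracting it from T leaves S, congruent to T modulo N and bijective
on each eigenlattice. Hence det S is prime to N and divides N^n, so S is invertible
(`exists_isUnit_intertwiner`). -/

/-! ### Lifting matrices of determinant one from ℤ/Q to ℤ -/

/-- The matrix that agrees with `G` on the coordinates `i`, `j` and with the identity on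
the others. -/
def embedPair {ι R : Type*} [DecidableEq ι] [CommRing R] (i j : ι) (G : Matrix (Fin 2) (Fin 2) R) :
    Matrix ι ι R :=
  1 + (Matrix.of fun r s => if r = ![i, j] s then 1 else 0 : Matrix ι (Fin 2) R) *
    ((G - 1) * (Matrix.of fun s r => if r = ![i, j] s then 1 else 0 : Matrix (Fin 2) ι R))

/-- The identity det(1 + AB) = det(1 + BA) moves the computation to size two, where the two
selection matrices compose to 1 because i ≠ j. -/
theorem det_embedPair {ι R : Type*} [Fintype ι] [DecidableEq ι] [CommRing R] {i j : ι}
    (hij : i ≠ j) (G : Matrix (Fin 2) (Fin 2) R) : (embedPair i j G).det = G.det := by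
  rw [embedPair, Matrix.det_one_add_mul_comm, Matrix.mul_assoc]
  have h : (Matrix.of fun s r => if r = ![i, j] s then 1 else 0 : Matrix (Fin 2) ι R) *
      (Matrix.of fun r s => if r = ![i, j] s then 1 else 0 : Matrix ι (Fin 2) R) = 1 := by
    ext r s
    fin_cases r <;> fin_cases s <;>
      simp only [Matrix.mul_apply, Matrix.of_apply, ite_mul, one_mul, zero_mul,
        Finset.sum_ite_eq', Finset.mem_univ, if_true] <;> simp [hij, hij.symm]
  rw [h, mul_one, add_sub_cancel]

theorem embedPair_map {ι R S : Type*} [DecidableEq ι] [CommRing R] [CommRing S]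
    (f : R →+* S) (i j : ι) (G : Matrix (Fin 2) (Fin 2) R) :
    (embedPair i j G).map f = embedPair i j (G.map f) := by
  ext r s
  simp [embedPair, Matrix.mul_apply, Matrix.one_apply, Fin.sum_univ_two, apply_ite f]

theorem embedPair_diagonal {ι R : Type*} [DecidableEq ι] [CommRing R] {i j : ι}
    (hij : i ≠ j) (x y : R) :
    embedPair i j (Matrix.diagonal ![x, y]) =
      Matrix.diagonal ((Pi.mulSingle i x : ι → R) * Pi.mulSingle j y) := by
  ext r s
  simp only [embedPair, Matrix.add_apply, Matrix.mul_apply, Fin.sum_univ_two, Matrix.one_apply,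
    Matrix.diagonal_apply, Pi.mul_apply, Pi.mulSingle_apply, Matrix.of_apply, Matrix.sub_apply]
  by_cases h1 : r = i <;> by_cases h2 : r = j <;> by_cases h3 : s = i <;> by_cases h4 : s = j <;>
    subst_vars <;> simp_all <;> split_ifs <;> simp_all

/-- The units `x` of `ZMod Q` for which the matrix `diagonal x` lifts to `GL (ι, ℤ)`. -/
noncomputable def diagLiftable (ι : Type*) [Fintype ι] [DecidableEq ι] (Q : ℕ) :
    Submonoid (ι → ZMod Q) :=
  (MonoidHom.mrange ((RingHom.mapMatrix (m := ι) (Int.castRingHom (ZMod Q))).toMonoidHom.comp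
    (Units.coeHom (Matrix ι ι ℤ)))).comap (Matrix.diagonalRingHom ι (ZMod Q)).toMonoidHom

theorem mem_diagLiftable {ι : Type*} [Fintype ι] [DecidableEq ι] {Q : ℕ} {x : ι → ZMod Q} :
    x ∈ diagLiftable ι Q ↔
      ∃ S : (Matrix ι ι ℤ)ˣ, (S : Matrix ι ι ℤ).map (Int.castRingHom (ZMod Q)) =
        Matrix.diagonal x := Iff.rfl

theorem mulSingle_mul_mulSingle_mem_diagLiftable {ι : Type*} [Fintype ι] [DecidableEq ι] {Q : ℕ}
    {i j : ι} (hij : i ≠ j) (x : (ZMod Q)ˣ) :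
    (Pi.mulSingle i (↑x⁻¹ : ZMod Q) * Pi.mulSingle j (x : ZMod Q) : ι → ZMod Q) ∈
      diagLiftable ι Q := by
  obtain ⟨a, ha⟩ := ZMod.intCast_surjective (x : ZMod Q)
  -- Bézout against Q² rather than Q leaves a factor Q for each off-diagonal entry: the determinant
  -- is exactly 1 and the matrix is diagonal modulo Q.
  have hcop : IsCoprime a ((Q : ℤ) ^ 2) :=
    ((ZMod.coe_int_isUnit_iff_isCoprime a Q).mp (ha ▸ x.isUnit)).symm.pow_right
  obtain ⟨d, s, hds⟩ := hcop
  have hdet : (embedPair i j !![d, -(Q * s); (Q : ℤ), a]).det = 1 := by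
    rw [det_embedPair hij, Matrix.det_fin_two_of]
    linear_combination hds
  have hd : (d : ZMod Q) = ↑x⁻¹ := by
    rw [← Units.mul_eq_one_iff_eq_inv, ← ha]
    have := congrArg (Int.cast : ℤ → ZMod Q) hds
    simpa using this
  rw [mem_diagLiftable]
  refine ⟨((Matrix.isUnit_iff_isUnit_det _).mpr (hdet ▸ isUnit_one)).unit, ?_⟩
  rw [IsUnit.unit_spec, embedPair_map, ← embedPair_diagonal hij]
  congr 1
  ext r s
  fin_cases r <;> fin_cases s <;> simp [ha, hd]

/-- Factor x into pairs (x_j⁻¹ at i₀, x_j at j), each of which lifts. What remains is the product of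
all x_j at i₀, a sign, which lifts to an integral diagonal matrix. -/
theorem mem_diagLiftable_of_prod_eq {ι : Type*} [Fintype ι] [DecidableEq ι] {Q : ℕ}
    (x : ι → (ZMod Q)ˣ) (ε : ℤˣ) (hx : ∏ i, (x i : ZMod Q) = ((ε : ℤ) : ZMod Q)) :
    (fun i => (x i : ZMod Q)) ∈ diagLiftable ι Q := by
  rcases isEmpty_or_nonempty ι with hι | ⟨⟨i₀⟩⟩
  · convert (diagLiftable ι Q).one_mem
  have key : (fun i => (x i : ZMod Q)) =
      (∏ j, (Pi.mulSingle i₀ (↑(x j)⁻¹ : ZMod Q) * Pi.mulSingle j (x j : ZMod Q))) *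
        Pi.mulSingle i₀ ((ε : ℤ) : ZMod Q) := by
    have h1 : ∏ j, (Pi.mulSingle i₀ (↑(x j)⁻¹ : ZMod Q) : ι → ZMod Q) *
        Pi.mulSingle i₀ (x j : ZMod Q) = 1 := by
      refine Finset.prod_eq_one fun j _ => ?_
      rw [← Pi.mulSingle_mul, Units.inv_mul, Pi.mulSingle_one]
    have h2 : ∏ j, (Pi.mulSingle i₀ (x j : ZMod Q) : ι → ZMod Q) =
        Pi.mulSingle i₀ ((ε : ℤ) : ZMod Q) := by
      rw [← hx]
      exact (map_prod (MonoidHom.mulSingle (fun _ : ι => ZMod Q) i₀) _ _).symm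
    rw [Finset.prod_mul_distrib, h2] at h1
    rw [Finset.prod_mul_distrib, Finset.univ_prod_mulSingle (fun i => (x i : ZMod Q)), mul_right_comm,
      h1, one_mul]
  rw [key]
  refine mul_mem (prod_mem fun j _ => ?_) ?_
  · rcases eq_or_ne i₀ j with rfl | hj
    · rw [← Pi.mulSingle_mul, Units.inv_mul, Pi.mulSingle_one]
      exact one_mem _
    · exact mulSingle_mul_mulSingle_mem_diagLiftable hj (x j)
  · rw [mem_diagLiftable]
    refine ⟨Units.map (Matrix.diagonalRingHom ι ℤ).toMonoidHom
      (MulEquiv.piUnits.symm (Pi.mulSingle i₀ ε)), ?_⟩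
    ext r s
    rcases eq_or_ne r s with rfl | hrs
    · by_cases h : r = i₀
      · subst h; simp
      · simp [h]
    · simp [hrs]

/-- Take bases adapted to the full-rank sublattice Mℤ^n and pull the one of Mℤ^n back along M. No
divisibility among the diagonal entries is needed. -/
theorem exists_eq_mul_diagonal_mul {ι : Type*} [Fintype ι] [DecidableEq ι] (M : Matrix ι ι ℤ)
    (hM : M.det ≠ 0) :
    ∃ (U V : (Matrix ι ι ℤ)ˣ) (d : ι → ℤ), M = U * Matrix.diagonal d * V := by
  have hinj : Function.Injective (Matrix.toLin' M) := by
    rw [← LinearMap.ker_eq_bot, Matrix.ker_toLin'_eq_bot_iff]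
    intro v hv
    exact Matrix.eq_zero_of_mulVec_eq_zero hM hv
  let e := LinearEquiv.ofInjective (Matrix.toLin' M) hinj
  obtain ⟨b, d, c, hc⟩ := Submodule.exists_smith_normal_form_of_rank_eq (Pi.basisFun ℤ ι)
    (LinearEquiv.finrank_eq e.symm)
  let c' := c.map e.symm
  have hc' : ∀ i, M.mulVec (c' i) = d i • b i := by
    intro i
    rw [← hc i, ← Matrix.toLin'_apply]
    exact congrArg Subtype.val (e.apply_symm_apply (c i))
  have hU := (Pi.basisFun ℤ ι).invertibleToMatrix b
  have hV := (Pi.basisFun ℤ ι).invertibleToMatrix c'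
  refine ⟨unitOfInvertible ((Pi.basisFun ℤ ι).toMatrix b),
    (unitOfInvertible ((Pi.basisFun ℤ ι).toMatrix c'))⁻¹, d, ?_⟩
  rw [Units.eq_mul_inv_iff_mul_eq]
  ext r s
  have := congrFun (hc' s) r
  simpa [Matrix.mul_apply, Matrix.mulVec, dotProduct, Module.Basis.toMatrix_apply,
    Matrix.diagonal_apply, mul_comm] using this

/-- An integral matrix of determinant `1` modulo `Q` is congruent to an invertible one. -/
theorem exists_unit_map_eq {ι : Type*} [Fintype ι] [DecidableEq ι] {Q : ℕ} (hQ : 1 < Q)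
    (M : Matrix ι ι ℤ) (hM : (M.det : ZMod Q) = 1) :
    ∃ S : (Matrix ι ι ℤ)ˣ, (S : Matrix ι ι ℤ).map (Int.castRingHom (ZMod Q)) =
      M.map (Int.castRingHom (ZMod Q)) := by
  have : Fact (1 < Q) := ⟨hQ⟩
  have hM0 : M.det ≠ 0 := by
    intro h
    rw [h, Int.cast_zero] at hM
    exact zero_ne_one hM
  -- The determinants of U and V are signs, so the diagonal entries multiply to a sign modulo Q;
  -- only the diagonal factor has to be lifted.
  obtain ⟨U, V, d, hd⟩ := exists_eq_mul_diagonal_mul M hM0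
  have hU := (Matrix.isUnit_iff_isUnit_det _).mp U.isUnit
  have hV := (Matrix.isUnit_iff_isUnit_det _).mp V.isUnit
  have hdet : M.det = (hU.unit * hV.unit : ℤˣ) * ∏ i, d i := by
    rw [hd, Matrix.det_mul, Matrix.det_mul, Matrix.det_diagonal]
    simp
    ring
  have hprod : ∏ i, (d i : ZMod Q) = (((hU.unit * hV.unit : ℤˣ) : ℤ) : ZMod Q) := by
    have h2 : (((hU.unit * hV.unit : ℤˣ) : ℤ) * (hU.unit * hV.unit : ℤˣ) : ℤ) = 1 := by
      rw [← Units.val_mul, Int.units_mul_self, Units.val_one]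
    have h3 := congrArg (Int.cast : ℤ → ZMod Q) h2
    rw [hdet] at hM
    push_cast at hM h3 ⊢
    linear_combination (norm := skip) (((hU.unit : ℤ) : ZMod Q) * ((hV.unit : ℤ) : ZMod Q)) * hM -
      (∏ i, (d i : ZMod Q)) * h3
    ring
  have hunit : ∀ i, IsUnit (d i : ZMod Q) := by
    intro i
    refine isUnit_of_dvd_unit (Finset.dvd_prod_of_mem (fun i => (d i : ZMod Q))
      (Finset.mem_univ i)) ?_
    rw [hprod]
    exact ((hU.unit * hV.unit).isUnit).map (Int.castRingHom (ZMod Q))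
  obtain ⟨S, hS⟩ := mem_diagLiftable.mp
    (mem_diagLiftable_of_prod_eq (fun i => (hunit i).unit) _ hprod)
  refine ⟨U * S * V, ?_⟩
  rw [hd, Units.val_mul, Units.val_mul, Matrix.map_mul, Matrix.map_mul, hS, Matrix.map_mul,
    Matrix.map_mul]
  congr 2
  ext r s
  rcases eq_or_ne r s with rfl | hrs
  · simp
  · simp [hrs]

/-! ### Rank one summands from the exponent of the Smith group -/

/-- Here c generates the ideal of values at v of all functionals, that is, the content of v, and w
is the primitive vector on its line. -/
theorem exists_eq_smul_dual_apply_eq_one {M : Type*} [AddCommGroup M] [Module.Free ℤ M]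
    [Module.Finite ℤ M] {v : M} (hv : v ≠ 0) :
    ∃ (c : ℤ) (w : M) (χ : Module.Dual ℤ M), v = c • w ∧ χ w = 1 := by
  let b := Module.Free.chooseBasis ℤ M
  let I : Ideal ℤ := LinearMap.range (Module.Dual.eval ℤ M v)
  obtain ⟨c, hc⟩ := (IsPrincipalIdealRing.principal I).principal
  have hdvd : ∀ i, c ∣ b.repr v i := by
    intro i
    rw [← Ideal.mem_span_singleton]
    change _ ∈ Submodule.span ℤ {c}
    rw [← hc]
    exact ⟨b.coord i, rfl⟩
  obtain ⟨χ, hχ⟩ : c ∈ I := by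
    rw [hc]
    exact Submodule.mem_span_singleton_self c
  choose d hd using hdvd
  have hw : v = c • ∑ i, d i • b i := by
    conv_lhs => rw [← b.sum_repr v]
    rw [Finset.smul_sum]
    exact Finset.sum_congr rfl fun i _ => by rw [hd i, mul_smul]
  refine ⟨c, _, χ, hw, ?_⟩
  have hc0 : c ≠ 0 := by
    rintro rfl
    exact hv (by rw [hw, zero_smul])
  refine mul_left_cancel₀ hc0 ?_
  rw [mul_one, ← smul_eq_mul, ← map_smul, ← hw]
  exact hχ

/-- E acts as q on its image, hence on the saturation of its image, since ℤ^n is torsion-free. -/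
theorem mulVec_eq_of_smul_mem_range {n : ℕ} {E : Matrix (Fin n) (Fin n) ℤ} {q : ℤ}
    (hE : E * E = q • E) {m : ℤ} (hm : m ≠ 0) {x : Fin n → ℤ}
    (hx : m • x ∈ LinearMap.range E.mulVecLin) : E.mulVec x = q • x := by
  obtain ⟨y, hy⟩ := hx
  rw [Matrix.mulVecLin_apply] at hy
  refine smul_right_injective _ hm ?_
  change m • E.mulVec x = m • q • x
  rw [← Matrix.mulVec_smul, ← hy, Matrix.mulVec_mulVec, hE, Matrix.smul_mulVec, hy, smul_comm]

/-- An abelian group of nonzero exponent has an element whose order is the exponent; v lifts such an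
element of the Smith group. -/
theorem exists_ne_zero_dvd_of_exponent_eq {n q : ℕ} {E : Matrix (Fin n) (Fin n) ℤ} (hq : q ≠ 0)
    (hE : E * E = (q : ℤ) • E) (hE0 : E ≠ 0)
    (hexp : AddMonoid.exponent (SmithGroup E) = q) :
    ∃ v : Fin n → ℤ, v ≠ 0 ∧ E.mulVec v = (q : ℤ) • v ∧
      ∀ m : ℤ, m • v ∈ LinearMap.range E.mulVecLin → (q : ℤ) ∣ m := by
  -- For q = 1 the lift could be zero, so a nonzero vector of the image is taken instead.
  rcases eq_or_ne q 1 with rfl | hq1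
  · obtain ⟨y, hy⟩ : ∃ y, E.mulVec y ≠ 0 := by
      by_contra! h
      refine hE0 (Matrix.mulVec_injective (funext fun y => ?_))
      rw [h y, Matrix.zero_mulVec]
    refine ⟨E.mulVec y, hy, ?_, fun m _ => by simp⟩
    rw [Matrix.mulVec_mulVec, hE, Matrix.smul_mulVec]
  obtain ⟨t, ht⟩ := AddMonoid.exists_addOrderOf_eq_exponent
    (AddMonoid.exponent_ne_zero.mp (by rw [hexp]; exact hq) : AddMonoid.ExponentExists (SmithGroup E))
  rw [hexp] at ht
  obtain ⟨v, hv⟩ := Submodule.mkQ_surjective _ (t : (Fin n → ℤ) ⧸ LinearMap.range E.mulVecLin)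
  have key : ∀ m : ℤ, m • v ∈ LinearMap.range E.mulVecLin ↔ (q : ℤ) ∣ m := by
    intro m
    rw [← ht, addOrderOf_dvd_iff_zsmul_eq_zero, ← Submodule.coe_eq_zero, Submodule.coe_smul, ← hv,
      ← map_smul, Submodule.mkQ_apply, Submodule.Quotient.mk_eq_zero]
  refine ⟨v, ?_, mulVec_eq_of_smul_mem_range hE (Int.natCast_ne_zero.mpr hq) ((key q).mpr dvd_rfl),
    fun m => (key m).mp⟩
  rintro rfl
  have := (key 1).mp (by simp)
  exact hq1 (by simpa [Int.natCast_dvd] using this)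

/-- If `E` is `q` times an idempotent and its Smith group has exponent `q`, then the lattice has a
direct summand of rank one that lies in the image of the idempotent. -/
theorem exists_rank_one_summand {n q : ℕ} {E : Matrix (Fin n) (Fin n) ℤ} (hq : q ≠ 0)
    (hE : E * E = (q : ℤ) • E) (hE0 : E ≠ 0)
    (hexp : AddMonoid.exponent (SmithGroup E) = q) :
    ∃ v φ : Fin n → ℤ, E.mulVec v = (q : ℤ) • v ∧ Matrix.vecMul φ E = (q : ℤ) • φ ∧
      φ ⬝ᵥ v = 1 := by
  obtain ⟨v₀, hv₀, hEv₀, hdvd₀⟩ := exists_ne_zero_dvd_of_exponent_eq hq hE hE0 hexp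
  have hqz : (q : ℤ) ≠ 0 := Int.natCast_ne_zero.mpr hq
  let R := LinearMap.range E.mulVecLin
  let K := LinearMap.ker (E.mulVecLin - (q : ℤ) • LinearMap.id)
  have hK : ∀ x, x ∈ K ↔ E.mulVec x = (q : ℤ) • x := fun x => by
    simp [K, sub_eq_zero]
  have hRK : R ≤ K := by
    rintro _ ⟨y, rfl⟩
    rw [hK, Matrix.mulVecLin_apply, Matrix.mulVec_mulVec, hE, Matrix.smul_mulVec]
  -- Dividing v₀ by its content in K makes v primitive there, and the order of v modulo R is still a
  -- multiple of q.
  obtain ⟨c₀, ⟨v, hvK⟩, χ, hcv, hχ⟩ := exists_eq_smul_dual_apply_eq_one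
    (v := (⟨v₀, (hK v₀).mpr hEv₀⟩ : K)) (fun h => hv₀ (congrArg Subtype.val h))
  have hcv' : v₀ = c₀ • v := congrArg Subtype.val hcv
  have hdvd : ∀ m : ℤ, m • v ∈ R → (q : ℤ) ∣ m := by
    intro m hm
    apply hdvd₀
    rw [hcv', smul_comm]
    exact R.smul_mem _ hm
  have hEv := (hK v).mp hvK
  have hv0 : v ≠ 0 := by
    rintro rfl
    exact hv₀ (by rw [hcv', smul_zero])
  have hqv : E.mulVec v ∈ R := ⟨v, rfl⟩
  obtain ⟨c, ⟨w, hwR⟩, ψ, hcw, hψ⟩ := exists_eq_smul_dual_apply_eq_one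
    (v := (⟨E.mulVec v, hqv⟩ : R)) (fun h => by
      have h' : E.mulVec v = 0 := congrArg Subtype.val h
      rw [hEv] at h'
      exact (smul_ne_zero hqz hv0) h')
  have hcw' : E.mulVec v = c • w := congrArg Subtype.val hcw
  -- Write qv = cw with w primitive in R. Applying χ gives q = cm, so w = mv lies in R and q divides
  -- m. Thus c = ±1: the vector qv is itself primitive in R.
  have hq' : (q : ℤ) = c * χ ⟨w, hRK hwR⟩ := by
    have h1 : (q : ℤ) • (⟨v, hvK⟩ : K) = c • ⟨w, hRK hwR⟩ := Subtype.ext (by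
      change (q : ℤ) • v = c • w
      rw [← hEv, hcw'])
    have h2 := congrArg χ h1
    rwa [map_smul, map_smul, hχ, smul_eq_mul, smul_eq_mul, mul_one] at h2
  set m := χ ⟨w, hRK hwR⟩
  have hc0 : c ≠ 0 := by
    rintro rfl
    exact hqz (by rw [hq', zero_mul])
  have hmw : m • v = w := by
    refine smul_right_injective _ hc0 ?_
    change c • m • v = c • w
    rw [← mul_smul, ← hq', ← hEv, hcw']
  have hm0 : m ≠ 0 := by
    intro h
    exact hqz (by rw [hq', h, mul_zero])
  have hcu : c * c = 1 := by
    obtain ⟨s, hs⟩ := hdvd m (hmw ▸ hwR)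
    refine Int.isUnit_mul_self (IsUnit.of_mul_eq_one s ?_)
    refine mul_right_cancel₀ hm0 ?_
    linear_combination -hs - s * hq'
  -- Composing with E gives φ ∘ E = qφ, and φ(v) = c·ψ(cw) = c² = 1; the factor c corrects the sign.
  let φ : Module.Dual ℤ (Fin n → ℤ) := c • ψ ∘ₗ E.mulVecLin.rangeRestrict
  have hφ : ∀ x, (fun i => φ (Pi.single i 1)) ⬝ᵥ x = φ x := by
    intro x
    conv_rhs => rw [← (Pi.basisFun ℤ (Fin n)).sum_repr x, map_sum]
    simp only [map_smul, Pi.basisFun_apply, Pi.basisFun_repr, smul_eq_mul]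
    exact Finset.sum_congr rfl fun i _ => mul_comm _ _
  refine ⟨v, fun i => φ (Pi.single i 1), hEv, ?_, ?_⟩
  · refine funext fun j => ?_
    have h1 : Matrix.vecMul (fun i => φ (Pi.single i 1)) E j = φ (E.mulVec (Pi.single j 1)) := by
      rw [← hφ, Matrix.mulVec_single_one]
      rfl
    have h2 : E.mulVecLin.rangeRestrict (E.mulVec (Pi.single j 1)) =
        (q : ℤ) • E.mulVecLin.rangeRestrict (Pi.single j 1) := Subtype.ext (by
      change E.mulVec (E.mulVec (Pi.single j 1)) = (q : ℤ) • E.mulVec (Pi.single j 1)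
      rw [Matrix.mulVec_mulVec, hE, Matrix.smul_mulVec])
    rw [h1]
    change c • ψ _ = (q : ℤ) • c • ψ _
    rw [h2, map_smul, smul_comm]
  · rw [hφ]
    change c • ψ ⟨E.mulVec v, hqv⟩ = 1
    rw [hcw, map_smul, hψ, smul_eq_mul, smul_eq_mul, mul_one, hcu]

/-! ### From local conjugacy to an intertwiner of determinant prime to N -/

theorem ratMatrix_mul {n : ℕ} (A B : Matrix (Fin n) (Fin n) ℤ) :
    ratMatrix (A * B) = ratMatrix A * ratMatrix B :=
  Matrix.map_mul (f := Int.castRingHom ℚ)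

theorem ratMatrix_injective {n : ℕ} :
    Function.Injective (ratMatrix : Matrix (Fin n) (Fin n) ℤ → Matrix (Fin n) (Fin n) ℚ) :=
  Matrix.map_injective Int.cast_injective

theorem det_ratMatrix {n : ℕ} (A : Matrix (Fin n) (Fin n) ℤ) :
    (ratMatrix A).det = (A.det : ℚ) :=
  ((Int.castRingHom ℚ).map_det A).symm

theorem exists_common_denominator {p : ℕ} [hp : Fact p.Prime] {ι : Type*} [Fintype ι]
    (x : ι → zLocal p) :
    ∃ (b : ℤ) (z : ι → ℤ), ¬ (p : ℤ) ∣ b ∧ ∀ i, (z i : ℚ) = (b : ℚ) * x i := by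
  have hpz := Nat.prime_iff_prime_int.mp hp.out
  choose c d hd hx using fun i => (x i).2
  have h := fun i => Finset.dvd_prod_of_mem d (Finset.mem_univ i)
  choose e he using h
  refine ⟨∏ i, d i, fun i => e i * c i, ?_, fun i => ?_⟩
  · rw [hpz.dvd_finsetProd_iff]
    rintro ⟨i, -, hi⟩
    exact hd i hi
  · have hd0 : (d i : ℚ) ≠ 0 := by
      intro h0
      exact hd i (by rw [Int.cast_eq_zero.mp h0]; exact dvd_zero _)
    rw [hx i, he i]
    push_cast
    field_simp

/-- Multiplying a local conjugator by a common denominator b prime to p changes its determinant, a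
unit at p, only by the factor b^n. -/
theorem exists_intertwiner_of_conjugateOver_zLocal {n p : ℕ} [hp : Fact p.Prime]
    {X Y : Matrix (Fin n) (Fin n) ℤ} (h : ConjugateOver (zLocal p) X Y) :
    ∃ A : Matrix (Fin n) (Fin n) ℤ, A * X = Y * A ∧ ¬ (p : ℤ) ∣ A.det := by
  have hpz := Nat.prime_iff_prime_int.mp hp.out
  obtain ⟨T, hT⟩ := h
  let ι := (zLocal p).subtype
  obtain ⟨b, z, hb, hz⟩ := exists_common_denominator
    (fun rs : Fin n × Fin n => (T : Matrix (Fin n) (Fin n) (zLocal p)) rs.1 rs.2)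
  let A : Matrix (Fin n) (Fin n) ℤ := Matrix.of fun r s => z (r, s)
  let T' : Matrix (Fin n) (Fin n) ℚ := ι.mapMatrix (T : Matrix (Fin n) (Fin n) (zLocal p))
  have hA : ratMatrix A = (b : ℚ) • T' := by
    ext r s
    exact hz (r, s)
  have hTX : (T : Matrix (Fin n) (Fin n) (zLocal p)) * X.map (Int.cast : ℤ → zLocal p) =
      Y.map (Int.cast : ℤ → zLocal p) * T := by
    rw [← hT, Matrix.mul_assoc, ← Units.val_mul, inv_mul_cancel, Units.val_one, mul_one]
  have hcast : ∀ Z : Matrix (Fin n) (Fin n) ℤ,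
      ι.mapMatrix (Z.map (Int.cast : ℤ → zLocal p)) = ratMatrix Z := fun Z => by
    ext r s
    simp [ratMatrix]
  have hTX' : T' * ratMatrix X = ratMatrix Y * T' := by
    rw [← hcast X, ← hcast Y, ← map_mul, ← map_mul, hTX]
  refine ⟨A, ratMatrix_injective ?_, ?_⟩
  · rw [ratMatrix_mul, ratMatrix_mul, hA, smul_mul_assoc, hTX', mul_smul_comm]
  · obtain ⟨c, d, hd, hcd⟩ := (((T⁻¹ : GL (Fin n) (zLocal p)) :
      Matrix (Fin n) (Fin n) (zLocal p)).det).2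
    have hdet : T'.det * ((c : ℚ) / d) = 1 := by
      rw [← hcd]
      change (ι.mapMatrix (T : Matrix (Fin n) (Fin n) (zLocal p))).det * ι _ = 1
      rw [← RingHom.map_det, ← map_mul, ← Matrix.det_mul, ← Units.val_mul, mul_inv_cancel,
        Units.val_one, Matrix.det_one, map_one]
    have hd0 : (d : ℚ) ≠ 0 := by
      intro h0
      exact hd (by rw [Int.cast_eq_zero.mp h0]; exact dvd_zero _)
    have hAdet : (A.det : ℚ) = (b : ℚ) ^ n * T'.det := by
      rw [← det_ratMatrix, hA, Matrix.det_smul, Fintype.card_fin]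
    have hint : A.det * c = b ^ n * d := by
      have : (A.det : ℚ) * c = (b : ℚ) ^ n * d := by
        rw [hAdet]
        field_simp at hdet
        rw [mul_assoc, hdet]
      exact_mod_cast this
    intro hdvd
    rcases hpz.dvd_or_dvd (hint ▸ hdvd.mul_right c : (p : ℤ) ∣ b ^ n * d) with h1 | h1
    · exact hb (hpz.dvd_of_dvd_pow h1)
    · exact hd h1

theorem dvd_det_sub_det {ι : Type*} [Fintype ι] [DecidableEq ι] {m : ℤ} {A B : Matrix ι ι ℤ}
    (h : ∀ i j, m ∣ A i j - B i j) : m ∣ A.det - B.det := by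
  let f := Ideal.Quotient.mk (Ideal.span {m})
  rw [← Ideal.mem_span_singleton, ← Ideal.Quotient.eq]
  change f A.det = f B.det
  rw [RingHom.map_det, RingHom.map_det]
  congr 1
  ext i j
  exact Ideal.Quotient.eq.mpr (Ideal.mem_span_singleton.mpr (h i j))

/-- Matrices that are conjugate over all localizations have an intertwiner whose determinant is
coprime to a given integer. -/
theorem exists_intertwiner_isCoprime_det {n : ℕ} {X Y : Matrix (Fin n) (Fin n) ℤ}
    (h : ∀ (p : ℕ) [Fact p.Prime], ConjugateOver (zLocal p) X Y) {N : ℕ} (hN : N ≠ 0) :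
    ∃ T : Matrix (Fin n) (Fin n) ℤ, T * X = Y * T ∧ IsCoprime T.det (N : ℤ) := by
  classical
  have hloc : ∀ p : ℕ, ∃ A : Matrix (Fin n) (Fin n) ℤ, A * X = Y * A ∧
      (p.Prime → ¬ (p : ℤ) ∣ A.det) := by
    intro p
    by_cases hp : p.Prime
    · have : Fact p.Prime := ⟨hp⟩
      obtain ⟨A, hA, hdet⟩ := exists_intertwiner_of_conjugateOver_zLocal (h p)
      exact ⟨A, hA, fun _ => hdet⟩
    · exact ⟨0, by simp, fun h => absurd h hp⟩
  choose A hA hdet using hloc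
  -- The coefficient of `A p` is prime to p and divisible by every other prime factor of N, so
  -- modulo p only the term of `A p` survives.
  let c : ℕ → ℤ := fun p => ∏ q ∈ N.primeFactors.erase p, (q : ℤ)
  refine ⟨∑ p ∈ N.primeFactors, c p • A p, ?_, ?_⟩
  · rw [Finset.sum_mul, Finset.mul_sum]
    exact Finset.sum_congr rfl fun p _ => by rw [smul_mul_assoc, hA, mul_smul_comm]
  · rw [Int.isCoprime_iff_gcd_eq_one, Int.gcd_eq_natAbs, Int.natAbs_natCast]
    refine Nat.Coprime.symm (Nat.coprime_of_dvd fun p hp hpN hpT => ?_)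
    have hpz := Nat.prime_iff_prime_int.mp hp
    have hpmem : p ∈ N.primeFactors := Nat.mem_primeFactors.mpr ⟨hp, hpN, hN⟩
    rw [← Int.natCast_dvd] at hpT
    have hcongr : (p : ℤ) ∣ (∑ p ∈ N.primeFactors, c p • A p).det - (c p • A p).det := by
      refine dvd_det_sub_det fun i j => ?_
      rw [← Matrix.sub_apply, ← Finset.sum_erase_eq_sub hpmem, Matrix.sum_apply]
      refine Finset.dvd_sum fun q hq => ?_
      rw [Matrix.smul_apply, smul_eq_mul]
      exact (Finset.dvd_prod_of_mem (fun q : ℕ => (q : ℤ)) (Finset.mem_erase.mpr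
        ⟨(Finset.ne_of_mem_erase hq).symm, hpmem⟩)).mul_right _
    have h1 := (dvd_sub_right hpT).mp hcongr
    rw [Matrix.det_smul] at h1
    rcases hpz.dvd_or_dvd h1 with h2 | h2
    · obtain ⟨q, hq, hpq⟩ := (hpz.dvd_finsetProd_iff _).mp (hpz.dvd_of_dvd_pow h2)
      rw [Int.natCast_dvd_natCast,
        Nat.prime_dvd_prime_iff_eq hp (Nat.prime_of_mem_primeFactors (Finset.mem_of_mem_erase hq))]
        at hpq
      exact Finset.ne_of_mem_erase hq hpq.symm
    · exact hdet p hp h2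

/-! ### Eigenlattices and determinants of induced maps -/

/-- The lattice of integral eigenvectors of `X` with eigenvalue `c`. -/
def eigenLattice {n : ℕ} (X : Matrix (Fin n) (Fin n) ℤ) (c : ℤ) : Submodule ℤ (Fin n → ℤ) :=
  LinearMap.ker (X.mulVecLin - c • LinearMap.id)

theorem mem_eigenLattice {n : ℕ} {X : Matrix (Fin n) (Fin n) ℤ} {c : ℤ} {x : Fin n → ℤ} :
    x ∈ eigenLattice X c ↔ X.mulVec x = c • x := by
  simp [eigenLattice, sub_eq_zero]

/-- The map that an intertwiner of `X` and `Y` induces on the eigenlattices. -/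
def eigenMap {n : ℕ} {X Y T : Matrix (Fin n) (Fin n) ℤ} (h : T * X = Y * T) (c : ℤ) :
    eigenLattice X c →ₗ[ℤ] eigenLattice Y c :=
  T.mulVecLin.restrict fun x hx => by
    rw [mem_eigenLattice] at hx ⊢
    rw [Matrix.mulVecLin_apply, Matrix.mulVec_mulVec, ← h, ← Matrix.mulVec_mulVec, hx,
      Matrix.mulVec_smul]

@[simp]
theorem coe_eigenMap {n : ℕ} {X Y T : Matrix (Fin n) (Fin n) ℤ} (h : T * X = Y * T) (c : ℤ)
    (x : eigenLattice X c) : (eigenMap h c x : Fin n → ℤ) = T.mulVec x := rfl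

theorem intertwine_mul {n : ℕ} {X Y Z S T : Matrix (Fin n) (Fin n) ℤ} (hT : T * X = Y * T)
    (hS : S * Y = Z * S) : S * T * X = Z * (S * T) := by
  rw [mul_assoc, hT, ← mul_assoc, hS, mul_assoc]

theorem eigenMap_mul {n : ℕ} {X Y Z S T : Matrix (Fin n) (Fin n) ℤ} (hT : T * X = Y * T)
    (hS : S * Y = Z * S) (c : ℤ) :
    eigenMap (intertwine_mul hT hS) c = eigenMap hS c ∘ₗ eigenMap hT c := by
  ext1 x
  exact Subtype.ext (Matrix.mulVec_mulVec (x : Fin n → ℤ) S T).symm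

theorem intertwine_adjugate {n : ℕ} {X Y T : Matrix (Fin n) (Fin n) ℤ} (hT : T * X = Y * T)
    (h0 : T.det ≠ 0) : T.adjugate * Y = X * T.adjugate := by
  have h1 : T.det • (T.adjugate * Y) = T.det • (X * T.adjugate) := by
    calc T.det • (T.adjugate * Y) = T.adjugate * (Y * T) * T.adjugate := by
          rw [mul_assoc, mul_assoc, Matrix.mul_adjugate, mul_smul_comm, mul_one, mul_smul_comm]
      _ = (T.adjugate * T) * (X * T.adjugate) := by rw [← hT]; simp only [mul_assoc]
      _ = T.det • (X * T.adjugate) := by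
          rw [Matrix.adjugate_mul, smul_mul_assoc, one_mul]
  exact smul_right_injective _ h0 h1

theorem eigenMap_injective {n : ℕ} {X Y T : Matrix (Fin n) (Fin n) ℤ} (hT : T * X = Y * T)
    (h0 : T.det ≠ 0) (c : ℤ) : Function.Injective (eigenMap hT c) := by
  rw [← LinearMap.ker_eq_bot, LinearMap.ker_eq_bot']
  intro x hx
  exact Subtype.ext (Matrix.eq_zero_of_mulVec_eq_zero h0 (congrArg Subtype.val hx))

/-- The intertwiner and its adjugate embed each lattice into the other, so the ranks agree. The
isomorphism is arbitrary: it serves only to give maps between the two lattices a determinant. -/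
theorem nonempty_eigenLattice_equiv {n : ℕ} {X Y T : Matrix (Fin n) (Fin n) ℤ} (hT : T * X = Y * T)
    (h0 : T.det ≠ 0) (c : ℤ) : Nonempty (eigenLattice Y c ≃ₗ[ℤ] eigenLattice X c) := by
  refine FiniteDimensional.nonempty_linearEquiv_of_finrank_eq (le_antisymm ?_ ?_)
  · refine LinearMap.finrank_le_finrank_of_injective
      (eigenMap_injective (intertwine_adjugate hT h0) ?_ c)
    rw [Matrix.det_adjugate]
    exact pow_ne_zero _ h0
  · exact LinearMap.finrank_le_finrank_of_injective (eigenMap_injective hT h0 c)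

/-- Following T by its adjugate is multiplication by det T, so the determinant in question divides a
power of det T. -/
theorem isCoprime_det_comp_eigenMap {n : ℕ} {X Y T : Matrix (Fin n) (Fin n) ℤ}
    (hT : T * X = Y * T) (h0 : T.det ≠ 0) {Q : ℤ} (hQ : IsCoprime T.det Q) (c : ℤ)
    (θ : eigenLattice Y c ≃ₗ[ℤ] eigenLattice X c) :
    IsCoprime (LinearMap.det (θ.toLinearMap ∘ₗ eigenMap hT c)) Q := by
  have hA := intertwine_adjugate hT h0
  have h1 : (eigenMap hA c ∘ₗ θ.symm.toLinearMap) ∘ₗ (θ.toLinearMap ∘ₗ eigenMap hT c) =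
      T.det • LinearMap.id := by
    ext1 x
    refine Subtype.ext ?_
    change T.adjugate.mulVec ((θ.symm (θ (eigenMap hT c x)) : eigenLattice Y c) : Fin n → ℤ) =
      T.det • (x : Fin n → ℤ)
    rw [θ.symm_apply_apply, coe_eigenMap, Matrix.mulVec_mulVec, Matrix.adjugate_mul,
      Matrix.smul_mulVec, Matrix.one_mulVec]
  have h2 := congrArg LinearMap.det h1
  rw [LinearMap.det_comp, LinearMap.det_smul, LinearMap.det_id, mul_one] at h2
  exact (h2 ▸ hQ.pow_left : IsCoprime (_ * _) Q).of_mul_left_right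

/-- An endomorphism of determinant `1` modulo `Q` is congruent to an automorphism. -/
theorem exists_equiv_add_smul {A : Type*} [AddCommGroup A] [Module.Free ℤ A] [Module.Finite ℤ A]
    {Q : ℕ} (hQ : 1 < Q) (f : A →ₗ[ℤ] A) (hf : (Q : ℤ) ∣ LinearMap.det f - 1) :
    ∃ (g : A ≃ₗ[ℤ] A) (h : A →ₗ[ℤ] A), ∀ x, f x = g x + (Q : ℤ) • h x := by
  classical
  let b := Module.Free.chooseBasis ℤ A
  let M := LinearMap.toMatrix b b f
  have hM : ((M.det : ℤ) : ZMod Q) = 1 := by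
    rw [LinearMap.det_toMatrix, ← Int.cast_one, eq_comm, ZMod.intCast_eq_intCast_iff_dvd_sub]
    exact hf
  obtain ⟨S, hS⟩ := exists_unit_map_eq hQ M hM
  have hdvd : ∀ i j, (Q : ℤ) ∣ M i j - (S : Matrix _ _ ℤ) i j := by
    intro i j
    rw [← ZMod.intCast_eq_intCast_iff_dvd_sub]
    exact congrFun (congrFun hS i) j
  choose H hH using hdvd
  have hSdet := (Matrix.isUnit_iff_isUnit_det _).mp S.isUnit
  refine ⟨LinearEquiv.ofIsUnitDet (f := Matrix.toLin b b S) (v := b) (v' := b)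
    (by rwa [LinearMap.toMatrix_toLin]), Matrix.toLin b b (Matrix.of H), fun x => ?_⟩
  have h1 : M = S + (Q : ℤ) • Matrix.of H := by
    ext i j
    rw [Matrix.add_apply, Matrix.smul_apply, Matrix.of_apply, smul_eq_mul, ← hH]
    ring
  have h2 : f = Matrix.toLin b b S + (Q : ℤ) • Matrix.toLin b b (Matrix.of H) := by
    rw [← map_smul, ← map_add, ← h1, Matrix.toLin_toMatrix]
  conv_lhs => rw [h2]
  rfl

/-! ### The commuting matrices 1 + t·vφ -/

theorem det_one_add_smul_vecMulVec {n : ℕ} (t : ℤ) {v φ : Fin n → ℤ} (h : φ ⬝ᵥ v = 1) :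
    (1 + t • Matrix.vecMulVec v φ).det = 1 + t := by
  have := Matrix.det_one_add_replicateCol_mul_replicateRow (ι := Unit) (t • v) φ
  rw [← Matrix.vecMulVec_eq, Matrix.smul_vecMulVec, dotProduct_smul, h] at this
  simpa using this

theorem one_add_smul_vecMulVec_comm {n : ℕ} {X : Matrix (Fin n) (Fin n) ℤ} {c : ℤ} (t : ℤ)
    {v φ : Fin n → ℤ} (hv : X.mulVec v = c • v) (hφ : Matrix.vecMul φ X = c • φ) :
    (1 + t • Matrix.vecMulVec v φ) * X = X * (1 + t • Matrix.vecMulVec v φ) := by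
  rw [add_mul, mul_add, one_mul, mul_one, smul_mul_assoc, mul_smul_comm, Matrix.vecMulVec_mul,
    Matrix.mul_vecMulVec, hv, hφ, Matrix.vecMulVec_smul, Matrix.smul_vecMulVec]

/-- On the eigenlattice containing v the matrix is the transvection x ↦ x + φ(x)·tv, of determinant
1 + t·φ(v). -/
theorem det_eigenMap_one_add_self {n : ℕ} {X : Matrix (Fin n) (Fin n) ℤ} {c : ℤ} (t : ℤ)
    {v φ : Fin n → ℤ} (hv : X.mulVec v = c • v) (hφ : Matrix.vecMul φ X = c • φ)
    (h : φ ⬝ᵥ v = 1) :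
    LinearMap.det (eigenMap (one_add_smul_vecMulVec_comm t hv hφ) c) = 1 + t := by
  let ψ : Module.Dual ℤ (eigenLattice X c) :=
    (dotProductBilin ℤ ℤ φ) ∘ₗ (eigenLattice X c).subtype
  have key : eigenMap (one_add_smul_vecMulVec_comm t hv hφ) c =
      LinearMap.transvection ψ (t • ⟨v, mem_eigenLattice.mpr hv⟩) := by
    ext1 x
    refine Subtype.ext ?_
    rw [coe_eigenMap, LinearMap.transvection.apply, Matrix.add_mulVec, Matrix.one_mulVec,
      Matrix.smul_mulVec, Matrix.vecMulVec_mulVec]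
    change _ = (x : Fin n → ℤ) + (φ ⬝ᵥ (x : Fin n → ℤ)) • t • v
    rw [op_smul_eq_smul, smul_comm]
  rw [key, LinearMap.transvection.det, map_smul]
  change 1 + t * (φ ⬝ᵥ v) = _
  rw [h, mul_one]

/-- A left eigenvector annihilates the right eigenvectors of any other eigenvalue, so the induced
map is the identity. -/
theorem det_eigenMap_one_add_of_ne {n : ℕ} {X : Matrix (Fin n) (Fin n) ℤ} {c d : ℤ} (t : ℤ)
    {v φ : Fin n → ℤ} (hv : X.mulVec v = c • v) (hφ : Matrix.vecMul φ X = c • φ) (hcd : c ≠ d) :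
    LinearMap.det (eigenMap (one_add_smul_vecMulVec_comm t hv hφ) d) = 1 := by
  have key : eigenMap (one_add_smul_vecMulVec_comm t hv hφ) d = LinearMap.id := by
    ext1 ⟨x, hx⟩
    refine Subtype.ext ?_
    have h0 : φ ⬝ᵥ x = 0 := by
      have h1 : φ ⬝ᵥ X.mulVec x = Matrix.vecMul φ X ⬝ᵥ x := Matrix.dotProduct_mulVec _ _ _
      rw [mem_eigenLattice.mp hx, hφ, dotProduct_smul, smul_dotProduct, smul_eq_mul,
        smul_eq_mul] at h1
      have h2 : (c - d) * (φ ⬝ᵥ x) = 0 := by linear_combination -h1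
      exact (mul_eq_zero.mp h2).resolve_left (sub_ne_zero.mpr hcd)
    rw [coe_eigenMap, Matrix.add_mulVec, Matrix.one_mulVec,
      Matrix.smul_mulVec, Matrix.vecMulVec_mulVec, h0]
    simp
  rw [key, LinearMap.det_id]

/-! ### Integral multiples of the primitive idempotents -/

theorem primIdem_mul_ratMatrix {n k : ℕ} {X : Matrix (Fin n) (Fin n) ℤ} {a : Fin k → ℤ}
    (ha : Function.Injective a) (hX : minpoly ℚ (ratMatrix X) = ∏ i, (Polynomial.X - C (a i : ℚ)))
    (i : Fin k) : primIdem X a i * ratMatrix X = (a i : ℚ) • primIdem X a i := by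
  simpa using primIdem_mul_aeval ha hX i Polynomial.X

theorem ratMatrix_mul_primIdem {n k : ℕ} {X : Matrix (Fin n) (Fin n) ℤ} {a : Fin k → ℤ}
    (ha : Function.Injective a) (hX : minpoly ℚ (ratMatrix X) = ∏ i, (Polynomial.X - C (a i : ℚ)))
    (i : Fin k) : ratMatrix X * primIdem X a i = (a i : ℚ) • primIdem X a i := by
  rw [← primIdem_mul_ratMatrix ha hX, primIdem]
  simpa using ((Commute.all Polynomial.X (Lagrange.basis Finset.univ (fun j => (a j : ℚ)) i)).map
    (aeval (ratMatrix X))).eq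

theorem primIdem_mul_self {n k : ℕ} {X : Matrix (Fin n) (Fin n) ℤ} {a : Fin k → ℤ}
    (ha : Function.Injective a) (hX : minpoly ℚ (ratMatrix X) = ∏ i, (Polynomial.X - C (a i : ℚ)))
    (i : Fin k) : primIdem X a i * primIdem X a i = primIdem X a i :=
  ((isPrimitiveIdempotentIn_iff ha hX _).mpr ⟨i, rfl⟩).2.1

theorem sum_primIdem {n k : ℕ} {X : Matrix (Fin n) (Fin n) ℤ} {a : Fin k → ℤ}
    (ha : Function.Injective a)
    (hX : minpoly ℚ (ratMatrix X) = ∏ i, (Polynomial.X - C (a i : ℚ))) :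
    ∑ i, primIdem X a i = 1 := by
  simpa using (eq_sum_primIdem ha hX 1).symm

theorem ratMatrix_smul {n : ℕ} (c : ℤ) (A : Matrix (Fin n) (Fin n) ℤ) :
    ratMatrix (c • A) = (c : ℚ) • ratMatrix A := by
  ext r s
  exact Int.cast_mul c (A r s)

/-- Common integral multiples of the primitive idempotents. -/
theorem exists_integral_multiples_primIdem {n k : ℕ} {X : Matrix (Fin n) (Fin n) ℤ} {a : Fin k → ℤ}
    (ha : Function.Injective a) (hX : minpoly ℚ (ratMatrix X) = ∏ i, (Polynomial.X - C (a i : ℚ)))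
    {N : ℕ} (hN : ∀ i, primDen X a i ∣ N) :
    ∃ F : Fin k → Matrix (Fin n) (Fin n) ℤ, (∀ i, F i * X = a i • F i) ∧
      (∀ i, X * F i = a i • F i) ∧ ∑ i, F i = (N : ℤ) • 1 := by
  choose c hc using hN
  have hF : ∀ i, ratMatrix ((c i : ℤ) • primNum X a i) = (N : ℚ) • primIdem X a i := by
    intro i
    rw [ratMatrix_smul, ratMatrix_primNum, smul_smul, hc i]
    push_cast
    rw [mul_comm]
  refine ⟨fun i => (c i : ℤ) • primNum X a i, fun i => ratMatrix_injective ?_,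
    fun i => ratMatrix_injective ?_, ratMatrix_injective ?_⟩
  · rw [ratMatrix_mul, ratMatrix_smul (a i), hF, smul_mul_assoc, primIdem_mul_ratMatrix ha hX,
      smul_comm]
  · rw [ratMatrix_mul, ratMatrix_smul (a i), hF, mul_smul_comm, ratMatrix_mul_primIdem ha hX,
      smul_comm]
  · have hsum : ratMatrix (∑ i, (c i : ℤ) • primNum X a i) =
        ∑ i, ratMatrix ((c i : ℤ) • primNum X a i) :=
      map_sum (RingHom.mapMatrix (m := Fin n) (Int.castRingHom ℚ)) _ _
    have hone : ratMatrix (1 : Matrix (Fin n) (Fin n) ℤ) = 1 :=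
      map_one (RingHom.mapMatrix (m := Fin n) (Int.castRingHom ℚ))
    rw [hsum, Finset.sum_congr rfl fun i _ => hF i, ← Finset.smul_sum, sum_primIdem ha hX,
      ratMatrix_smul, hone, Int.cast_natCast]

theorem primDen_ne_zero {n k : ℕ} (X : Matrix (Fin n) (Fin n) ℤ) (a : Fin k → ℤ) (i : Fin k) :
    primDen X a i ≠ 0 := Matrix.den_ne_zero _

theorem primNum_ne_zero {n k : ℕ} {X : Matrix (Fin n) (Fin n) ℤ} {a : Fin k → ℤ}
    (ha : Function.Injective a) (hX : minpoly ℚ (ratMatrix X) = ∏ i, (Polynomial.X - C (a i : ℚ)))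
    (i : Fin k) : primNum X a i ≠ 0 :=
  fun h => primIdem_ne_zero ha hX i (Matrix.num_eq_zero_iff _ |>.mp h)

theorem primNum_mul_self {n k : ℕ} {X : Matrix (Fin n) (Fin n) ℤ} {a : Fin k → ℤ}
    (ha : Function.Injective a) (hX : minpoly ℚ (ratMatrix X) = ∏ i, (Polynomial.X - C (a i : ℚ)))
    (i : Fin k) :
    primNum X a i * primNum X a i = (primDen X a i : ℤ) • primNum X a i := by
  apply ratMatrix_injective
  rw [ratMatrix_mul, ratMatrix_smul, ratMatrix_primNum, smul_mul_smul_comm,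
    primIdem_mul_self ha hX, smul_smul, Int.cast_natCast]

theorem mul_primNum {n k : ℕ} {X : Matrix (Fin n) (Fin n) ℤ} {a : Fin k → ℤ}
    (ha : Function.Injective a) (hX : minpoly ℚ (ratMatrix X) = ∏ i, (Polynomial.X - C (a i : ℚ)))
    (i : Fin k) : X * primNum X a i = a i • primNum X a i := by
  apply ratMatrix_injective
  rw [ratMatrix_mul, ratMatrix_smul, ratMatrix_primNum, mul_smul_comm,
    ratMatrix_mul_primIdem ha hX, smul_comm]

theorem primNum_mul {n k : ℕ} {X : Matrix (Fin n) (Fin n) ℤ} {a : Fin k → ℤ}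
    (ha : Function.Injective a) (hX : minpoly ℚ (ratMatrix X) = ∏ i, (Polynomial.X - C (a i : ℚ)))
    (i : Fin k) : primNum X a i * X = a i • primNum X a i := by
  apply ratMatrix_injective
  rw [ratMatrix_mul, ratMatrix_smul, ratMatrix_primNum, smul_mul_assoc,
    primIdem_mul_ratMatrix ha hX, smul_comm]

/-- Since v and φ are fixed by e_i, and X acts on e_i from either side as a_i, both are eigenvectors
of X; the factor q_i is cancelled at the end. -/
theorem SmithExponentCondition.exists_eigenvectors {n k : ℕ} {X : Matrix (Fin n) (Fin n) ℤ}
    {a : Fin k → ℤ} {i : Fin k} (h : SmithExponentCondition X a i) (ha : Function.Injective a)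
    (hX : minpoly ℚ (ratMatrix X) = ∏ i, (Polynomial.X - C (a i : ℚ))) :
    ∃ v φ : Fin n → ℤ, X.mulVec v = a i • v ∧ Matrix.vecMul φ X = a i • φ ∧ φ ⬝ᵥ v = 1 := by
  have hq := primDen_ne_zero X a i
  obtain ⟨v, φ, hv, hφ, hφv⟩ := exists_rank_one_summand hq (primNum_mul_self ha hX i)
    (primNum_ne_zero ha hX i) h
  have hqz : (primDen X a i : ℤ) ≠ 0 := Int.natCast_ne_zero.mpr hq
  refine ⟨v, φ, smul_right_injective _ hqz ?_, smul_right_injective _ hqz ?_, hφv⟩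
  · change (primDen X a i : ℤ) • X.mulVec v = (primDen X a i : ℤ) • a i • v
    rw [← Matrix.mulVec_smul, ← hv, Matrix.mulVec_mulVec, mul_primNum ha hX, Matrix.smul_mulVec,
      hv, smul_comm]
  · change (primDen X a i : ℤ) • Matrix.vecMul φ X = (primDen X a i : ℤ) • a i • φ
    rw [← Matrix.smul_vecMul, ← hφ, Matrix.vecMul_vecMul, primNum_mul ha hX, Matrix.vecMul_smul,
      hφ, smul_comm]

/-- Stated over a domain to cover both the idempotents themselves over ℚ, with N = 1, and their
integral multiples over ℤ. -/
theorem mulVec_eq_ite_of_eigenvector {R : Type*} [CommRing R] [IsDomain R] {n k : ℕ}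
    {X : Matrix (Fin n) (Fin n) R} {a : Fin k → R} (ha : Function.Injective a)
    {F : Fin k → Matrix (Fin n) (Fin n) R} (hFX : ∀ i, F i * X = a i • F i) {N : R}
    (hF : ∑ i, F i = N • 1) {j : Fin k} {x : Fin n → R} (hx : X.mulVec x = a j • x) (i : Fin k) :
    (F i).mulVec x = if i = j then N • x else 0 := by
  have hne : ∀ i, i ≠ j → (F i).mulVec x = 0 := by
    intro i hi
    have h1 : a j • (F i).mulVec x = a i • (F i).mulVec x := by
      rw [← Matrix.mulVec_smul, ← hx, Matrix.mulVec_mulVec, hFX, Matrix.smul_mulVec]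
    rw [← sub_eq_zero, ← sub_smul] at h1
    exact (smul_eq_zero.mp h1).resolve_left (sub_ne_zero.mpr fun h => hi (ha h).symm)
  split_ifs with hij
  · subst hij
    have h1 := congrArg (fun M => Matrix.mulVec M x) hF
    simp only [Matrix.sum_mulVec, Matrix.smul_mulVec, Matrix.one_mulVec] at h1
    rw [← h1, Finset.sum_eq_single i (fun j _ hj => hne j hj) (fun h => absurd (Finset.mem_univ i) h)]
  · exact hne i hij

/-- A ℤ-basis of the eigenlattice stays independent over ℚ and lies in the image of e_i, which
bounds the rank by one. The lattice is nonzero because it contains the image of E_i. -/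
theorem finrank_eigenLattice_eq_one {n k : ℕ} {X : Matrix (Fin n) (Fin n) ℤ} {a : Fin k → ℤ}
    (ha : Function.Injective a) (hX : minpoly ℚ (ratMatrix X) = ∏ i, (Polynomial.X - C (a i : ℚ)))
    {i : Fin k} (h : (primIdem X a i).rank = 1) :
    Module.finrank ℤ (eigenLattice X (a i)) = 1 := by
  refine le_antisymm ?_ (Nat.one_le_iff_ne_zero.mpr fun h0 => ?_)
  · let b := Module.Free.chooseBasis ℤ (eigenLattice X (a i))
    let ι : (Fin n → ℤ) →ₗ[ℤ] (Fin n → ℚ) := (Algebra.linearMap ℤ ℚ).compLeft (Fin n)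
    have hι : Function.Injective ι := fun x y hxy =>
      funext fun j => Int.cast_injective (congrFun hxy j)
    have hmem : ∀ x : eigenLattice X (a i),
        ι x ∈ LinearMap.range (primIdem X a i).mulVecLin := by
      intro ⟨x, hx⟩
      have hx' : (ratMatrix X).mulVec (ι x) = (a i : ℚ) • ι x := by
        have h1 : (ratMatrix X).mulVec (ι x) = ι (X.mulVec x) :=
          (RingHom.map_mulVec (Int.castRingHom ℚ) X x ·) |> funext |>.symm
        rw [h1, mem_eigenLattice.mp hx, map_smul, Int.cast_smul_eq_zsmul]
      have h2 := mulVec_eq_ite_of_eigenvector (Int.cast_injective.comp ha)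
        (primIdem_mul_ratMatrix ha hX) ((sum_primIdem ha hX).trans (one_smul ℚ _).symm) hx' i
      rw [if_pos rfl, one_smul] at h2
      exact ⟨ι x, h2⟩
    have hli : LinearIndependent ℤ (fun j => ι (b j)) :=
      b.linearIndependent.map' (ι ∘ₗ (eigenLattice X (a i)).subtype)
        (LinearMap.ker_eq_bot.mpr (hι.comp Subtype.val_injective))
    have hli' : LinearIndependent ℚ (fun j => ι (b j)) :=
      (LinearIndependent.iff_fractionRing ℤ ℚ).mp hli
    have hli2 : LinearIndependent ℚ (fun j =>
        (⟨ι (b j), hmem (b j)⟩ : LinearMap.range (primIdem X a i).mulVecLin)) :=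
      LinearIndependent.of_comp (Submodule.subtype _) hli'
    have := hli2.fintype_card_le_finrank
    rw [← Module.finrank_eq_card_basis b] at this
    exact this.trans h.le
  · refine primNum_ne_zero ha hX i (Matrix.mulVec_injective (funext fun y => ?_))
    have hy : (primNum X a i).mulVec y ∈ eigenLattice X (a i) := by
      rw [mem_eigenLattice, Matrix.mulVec_mulVec, mul_primNum ha hX, Matrix.smul_mulVec]
    have := Module.finrank_zero_iff.mp h0
    rw [Matrix.zero_mulVec]
    exact congrArg Subtype.val (Subsingleton.elim (⟨_, hy⟩ : eigenLattice X (a i)) 0)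

/-! ### Prescribing determinants by matrices commuting with X -/

theorem exists_inverse_modEq {d Q : ℤ} (h : IsCoprime d Q) : ∃ u : ℤ, IsCoprime u Q ∧
    Q ∣ u * d - 1 := by
  obtain ⟨u, t, hut⟩ := h
  exact ⟨u, ⟨d, t, by linear_combination hut⟩, -t, by linear_combination hut⟩

/-- An integral matrix commuting with `X` with prescribed determinants modulo `Q` on those
eigenlattices that contain a direct summand of rank one. -/
theorem exists_commuting_det_modEq {n k : ℕ} {X : Matrix (Fin n) (Fin n) ℤ} {a : Fin k → ℤ}
    (ha : Function.Injective a) {Q : ℤ} {D : Fin k → ℤ} (hD : ∀ i, IsCoprime (D i) Q)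
    (s : Finset (Fin k))
    (hs : ∀ i ∈ s, ∃ v φ : Fin n → ℤ, X.mulVec v = a i • v ∧ Matrix.vecMul φ X = a i • φ ∧
      φ ⬝ᵥ v = 1) :
    ∃ (W : Matrix (Fin n) (Fin n) ℤ) (hW : W * X = X * W), IsCoprime W.det Q ∧
      (∀ i ∈ s, Q ∣ LinearMap.det (eigenMap hW (a i)) * D i - 1) ∧
      ∀ i ∉ s, LinearMap.det (eigenMap hW (a i)) = 1 := by
  induction s using Finset.induction_on with
  | empty =>
    refine ⟨1, by simp, by simpa using isCoprime_one_left, by simp, fun i _ => ?_⟩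
    have key : ∀ hW : 1 * X = X * 1, eigenMap hW (a i) = LinearMap.id := fun hW => by
      ext1 x
      exact Subtype.ext (Matrix.one_mulVec _)
    rw [key, LinearMap.det_id]
  | insert i s his ih =>
    obtain ⟨W, hW, hdet, hWs, hWs'⟩ := ih fun j hj => hs j (Finset.mem_insert_of_mem hj)
    obtain ⟨v, φ, hv, hφ, hφv⟩ := hs i (Finset.mem_insert_self i s)
    obtain ⟨u, hu, hud⟩ := exists_inverse_modEq (hD i)
    -- With t = u - 1 the new factor has determinant u on the eigenlattice of index i and 1 on all
    -- others, so the earlier corrections persist.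
    have hU := one_add_smul_vecMulVec_comm (u - 1) hv hφ
    refine ⟨_, intertwine_mul hW hU, ?_, fun j hj => ?_, fun j hj => ?_⟩
    · rw [Matrix.det_mul, det_one_add_smul_vecMulVec _ hφv, add_sub_cancel]
      exact hu.mul_left hdet
    · rw [eigenMap_mul hW hU, LinearMap.det_comp]
      rcases eq_or_ne j i with rfl | hji
      · rwa [det_eigenMap_one_add_self _ hv hφ hφv, hWs' j his, mul_one, add_sub_cancel]
      · rw [det_eigenMap_one_add_of_ne _ hv hφ (fun h => hji (ha h).symm), one_mul]
        exact hWs j (Finset.mem_of_mem_insert_of_ne hj hji)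
    · rw [Finset.mem_insert, not_or] at hj
      rw [eigenMap_mul hW hU, LinearMap.det_comp,
        det_eigenMap_one_add_of_ne _ hv hφ (fun h => hj.1 (ha h).symm), one_mul, hWs' j hj.2]

/-- In case (b) the scalar u has determinant u on the first eigenlattice, whose rank is one, and so
corrects it. The remaining eigenlattices are then corrected by rank one summands, leaving the first
untouched. -/
theorem SmithAssumption.exists_commuting_det_modEq {n k : ℕ} {X : Matrix (Fin n) (Fin n) ℤ}
    {a : Fin k → ℤ} (hass : SmithAssumption X a) (ha : Function.Injective a)
    (hX : minpoly ℚ (ratMatrix X) = ∏ i, (Polynomial.X - C (a i : ℚ)))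
    {Q : ℤ} {D : Fin k → ℤ} (hD : ∀ i, IsCoprime (D i) Q) :
    ∃ (W : Matrix (Fin n) (Fin n) ℤ) (hW : W * X = X * W), IsCoprime W.det Q ∧
      ∀ i, Q ∣ LinearMap.det (eigenMap hW (a i)) * D i - 1 := by
  rcases hass with h | ⟨hk, hrank, h⟩
  · obtain ⟨W, hW, hdet, hWs, -⟩ := _root_.exists_commuting_det_modEq ha hD Finset.univ
      fun i _ => (h i).exists_eigenvectors ha hX
    exact ⟨W, hW, hdet, fun i => hWs i (Finset.mem_univ i)⟩
  · set i₀ : Fin k := ⟨0, hk⟩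
    obtain ⟨u, hu, hud⟩ := exists_inverse_modEq (hD i₀)
    have hU : (u • 1 : Matrix (Fin n) (Fin n) ℤ) * X = X * (u • 1) := by
      rw [smul_mul_assoc, one_mul, mul_smul_comm, mul_one]
    have hUdet : ∀ c, LinearMap.det (eigenMap hU c) =
        u ^ Module.finrank ℤ (eigenLattice X c) := by
      intro c
      have key : eigenMap hU c = u • LinearMap.id := by
        ext1 x
        refine Subtype.ext ?_
        rw [coe_eigenMap, Matrix.smul_mulVec, Matrix.one_mulVec]
        rfl
      rw [key, LinearMap.det_smul, LinearMap.det_id, mul_one]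
    obtain ⟨W, hW, hdet, hWs, hWs'⟩ := _root_.exists_commuting_det_modEq ha
      -- The scalar also changes the other determinants, by powers of u; these are absorbed into the
      -- values to be inverted.
      (D := fun i => LinearMap.det (eigenMap hU (a i)) * D i)
      (fun i => by
        rw [hUdet]
        exact hu.pow_left.mul_left (hD i))
      (Finset.univ.erase i₀)
      fun i hi => (h i (Finset.ne_of_mem_erase hi)).exists_eigenvectors ha hX
    refine ⟨_, intertwine_mul hU hW, ?_, fun i => ?_⟩
    · rw [Matrix.det_mul, Matrix.det_smul, Matrix.det_one, mul_one]
      exact hdet.mul_left hu.pow_left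
    · rw [eigenMap_mul hU hW, LinearMap.det_comp]
      rcases eq_or_ne i i₀ with rfl | hi
      · rwa [hWs' i₀ (Finset.notMem_erase _ _), hUdet,
          finrank_eigenLattice_eq_one ha hX hrank, pow_one, one_mul]
      · rw [mul_assoc]
        exact hWs i (Finset.mem_erase.mpr ⟨hi, Finset.mem_univ i⟩)

/-! ### Correcting an intertwiner to an invertible one -/

/-- An intertwiner whose determinants on the eigenlattices are `1` modulo `N ^ 2` can be replaced
by an invertible one. -/
theorem exists_isUnit_intertwiner {n k N : ℕ} (hN : 1 < N) {X Y T : Matrix (Fin n) (Fin n) ℤ}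
    {a : Fin k → ℤ} (ha : Function.Injective a)
    {F G : Fin k → Matrix (Fin n) (Fin n) ℤ}
    (hFX : ∀ i, F i * X = a i • F i) (hXF : ∀ i, X * F i = a i • F i)
    (hF : ∑ i, F i = (N : ℤ) • 1)
    (hGY : ∀ i, G i * Y = a i • G i) (hYG : ∀ i, Y * G i = a i • G i)
    (hG : ∑ i, G i = (N : ℤ) • 1)
    (hT : T * X = Y * T) (hdet : IsCoprime T.det N)
    (θ : ∀ i, eigenLattice Y (a i) ≃ₗ[ℤ] eigenLattice X (a i))
    (hθ : ∀ i, ((N ^ 2 : ℕ) : ℤ) ∣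
      LinearMap.det ((θ i).toLinearMap ∘ₗ eigenMap hT (a i)) - 1) :
    ∃ S : Matrix (Fin n) (Fin n) ℤ, IsUnit S ∧ S * X = Y * S := by
  have hN0 : (N : ℤ) ≠ 0 := by exact_mod_cast (by omega : N ≠ 0)
  -- One factor N pays for extending h_i from the eigenlattices to ℤ^n through F_i, which acts there
  -- as N; the other keeps the corrected matrix congruent to T modulo N.
  choose g h hgh using fun i => exists_equiv_add_smul (one_lt_pow₀ hN two_ne_zero) _ (hθ i)
  have hFmem : ∀ i x, (F i).mulVecLin x ∈ eigenLattice X (a i) := fun i x => by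
    rw [mem_eigenLattice, Matrix.mulVecLin_apply, Matrix.mulVec_mulVec, hXF, Matrix.smul_mulVec]
  have hGmem : ∀ i x, (G i).mulVecLin x ∈ eigenLattice Y (a i) := fun i x => by
    rw [mem_eigenLattice, Matrix.mulVecLin_apply, Matrix.mulVec_mulVec, hYG, Matrix.smul_mulVec]
  let pF := fun i => (F i).mulVecLin.codRestrict _ (hFmem i)
  let pG := fun i => (G i).mulVecLin.codRestrict _ (hGmem i)
  let H : (Fin n → ℤ) →ₗ[ℤ] (Fin n → ℤ) :=
    ∑ i, (eigenLattice Y (a i)).subtype ∘ₗ (θ i).symm.toLinearMap ∘ₗ h i ∘ₗ pF i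
  -- R is N times the inverse of the corrected matrix, built eigenlattice by eigenlattice.
  let R : (Fin n → ℤ) →ₗ[ℤ] (Fin n → ℤ) :=
    ∑ i, (eigenLattice X (a i)).subtype ∘ₗ (g i).symm.toLinearMap ∘ₗ (θ i).toLinearMap ∘ₗ pG i
  let S := T - (N : ℤ) • LinearMap.toMatrix' H
  have hS : ∀ x, S.mulVec x = T.mulVec x - (N : ℤ) • H x := fun x => by
    rw [Matrix.sub_mulVec, Matrix.smul_mulVec, LinearMap.toMatrix'_mulVec]
  have hHapp : ∀ x, H x = ∑ i, ((θ i).symm (h i (pF i x)) : Fin n → ℤ) := fun x => by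
    simp [H, LinearMap.sum_apply]
  have hRapp : ∀ x, R x = ∑ i, ((g i).symm (θ i (pG i x)) : Fin n → ℤ) := fun x => by
    simp [R, LinearMap.sum_apply]
  have hpF : ∀ j (x : eigenLattice X (a j)) i,
      (pF i x : Fin n → ℤ) = if i = j then (N : ℤ) • (x : Fin n → ℤ) else 0 := fun j x i =>
    mulVec_eq_ite_of_eigenvector ha hFX hF (mem_eigenLattice.mp x.2) i
  have hpG : ∀ j (x : eigenLattice Y (a j)) i,
      (pG i x : Fin n → ℤ) = if i = j then (N : ℤ) • (x : Fin n → ℤ) else 0 := fun j x i =>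
    mulVec_eq_ite_of_eigenvector ha hGY hG (mem_eigenLattice.mp x.2) i
  have hHeig : ∀ j (x : eigenLattice X (a j)),
      H x = (N : ℤ) • ((θ j).symm (h j x) : Fin n → ℤ) := by
    intro j x
    rw [hHapp, Finset.sum_eq_single j]
    · have : pF j x = (N : ℤ) • x := Subtype.ext (by simpa using hpF j x j)
      rw [this, map_smul, map_smul, Submodule.coe_smul]
    · intro i _ hij
      have : pF i x = 0 := Subtype.ext (by simpa [hij] using hpF j x i)
      rw [this, map_zero, map_zero, Submodule.coe_zero]
    · exact fun h => absurd (Finset.mem_univ j) h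
  have hReig : ∀ j (x : eigenLattice Y (a j)),
      R x = (N : ℤ) • ((g j).symm (θ j x) : Fin n → ℤ) := by
    intro j x
    rw [hRapp, Finset.sum_eq_single j]
    · have : pG j x = (N : ℤ) • x := Subtype.ext (by simpa using hpG j x j)
      rw [this, map_smul, map_smul, Submodule.coe_smul]
    · intro i _ hij
      have : pG i x = 0 := Subtype.ext (by simpa [hij] using hpG j x i)
      rw [this, map_zero, map_zero, Submodule.coe_zero]
    · exact fun h => absurd (Finset.mem_univ j) h
  have hSeig : ∀ j (x : eigenLattice X (a j)),
      S.mulVec x = ((θ j).symm (g j x) : Fin n → ℤ) := by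
    intro j x
    have h1 : eigenMap hT (a j) x =
        (θ j).symm (g j x) + ((N ^ 2 : ℕ) : ℤ) • (θ j).symm (h j x) := by
      rw [← map_smul, ← map_add, ← hgh j x]
      simp
    have h2 := congrArg Subtype.val h1
    rw [coe_eigenMap, Submodule.coe_add, Submodule.coe_smul] at h2
    rw [hS, hHeig, h2, smul_smul]
    push_cast
    rw [sq, add_sub_cancel_right]
  -- The identity holds on each eigenlattice, and Nx is a sum of eigenvectors; the extra N is
  -- cancelled.
  have hRS : ∀ x, R (S.mulVec x) = (N : ℤ) • x := by
    intro x
    refine smul_right_injective _ hN0 ?_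
    change (N : ℤ) • R (S.mulVec x) = (N : ℤ) • (N : ℤ) • x
    have hx : (N : ℤ) • x = ∑ i, (pF i x : Fin n → ℤ) := by
      have := congrArg (fun M => Matrix.mulVec M x) hF
      simp only [Matrix.sum_mulVec, Matrix.smul_mulVec, Matrix.one_mulVec] at this
      exact this.symm
    rw [← map_smul, ← Matrix.mulVec_smul, hx, Matrix.mulVec_sum, map_sum, Finset.smul_sum]
    refine Finset.sum_congr rfl fun i _ => ?_
    rw [hSeig, hReig, LinearEquiv.apply_symm_apply, LinearEquiv.symm_apply_apply]
  have hRSm : LinearMap.toMatrix' R * S = (N : ℤ) • 1 := by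
    refine Matrix.mulVec_injective (funext fun x => ?_)
    rw [← Matrix.mulVec_mulVec, LinearMap.toMatrix'_mulVec, hRS, Matrix.smul_mulVec,
      Matrix.one_mulVec]
  refine ⟨S, (Matrix.isUnit_iff_isUnit_det _).mpr ?_, ?_⟩
  · have h1 : S.det ∣ (N : ℤ) ^ n := by
      refine ⟨(LinearMap.toMatrix' R).det, ?_⟩
      rw [mul_comm, ← Matrix.det_mul, hRSm, Matrix.det_smul, Matrix.det_one, mul_one,
        Fintype.card_fin]
    have h2 : IsCoprime S.det N := by
      obtain ⟨c, hc⟩ : (N : ℤ) ∣ S.det - T.det := dvd_det_sub_det fun i j =>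
        ⟨-(LinearMap.toMatrix' H i j), by
          change T i j - (N : ℤ) * LinearMap.toMatrix' H i j - T i j = _
          ring⟩
      rw [sub_eq_iff_eq_add'.mp hc]
      exact hdet.add_mul_left_left c
    exact (h2.pow_right (n := n)).isUnit_of_dvd' dvd_rfl h1
  · refine Matrix.mulVec_injective (funext fun x => ?_)
    have hHX : H (X.mulVec x) = Y.mulVec (H x) := by
      rw [hHapp, hHapp, Matrix.mulVec_sum]
      refine Finset.sum_congr rfl fun i _ => ?_
      have h1 : pF i (X.mulVec x) = a i • pF i x := Subtype.ext (by
        change (F i).mulVec (X.mulVec x) = a i • (F i).mulVec x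
        rw [Matrix.mulVec_mulVec, hFX, Matrix.smul_mulVec])
      rw [h1, map_smul, map_smul, Submodule.coe_smul,
        mem_eigenLattice.mp ((θ i).symm (h i (pF i x))).2]
    rw [← Matrix.mulVec_mulVec, ← Matrix.mulVec_mulVec, hS, hS, Matrix.mulVec_sub,
      Matrix.mulVec_smul, hHX, Matrix.mulVec_mulVec, Matrix.mulVec_mulVec, hT]

/-! ### The local-global principle -/

theorem ConjugateOver.of_int {R : Type*} [CommRing R] {n : ℕ} {X Y : Matrix (Fin n) (Fin n) ℤ}
    (h : ConjugateOver ℤ X Y) : ConjugateOver R X Y := by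
  obtain ⟨T, hT⟩ := h
  refine ⟨Units.map (RingHom.mapMatrix (Int.castRingHom R)).toMonoidHom T, ?_⟩
  have h1 := congrArg (RingHom.mapMatrix (Int.castRingHom R)) hT
  rw [map_mul, map_mul] at h1
  have hcast : ∀ Z : Matrix (Fin n) (Fin n) ℤ, RingHom.mapMatrix (Int.castRingHom R)
      (Z.map (Int.cast : ℤ → ℤ)) = Z.map (Int.cast : ℤ → R) := fun Z => by
    ext r s
    simp
  rw [hcast, hcast] at h1
  exact h1

theorem conjugateOver_int_of_isUnit {n : ℕ} {X Y S : Matrix (Fin n) (Fin n) ℤ} (hS : IsUnit S)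
    (h : S * X = Y * S) : ConjugateOver ℤ X Y := by
  have hcast : ∀ Z : Matrix (Fin n) (Fin n) ℤ, Z.map (Int.cast : ℤ → ℤ) = Z := fun Z => by
    ext r s
    simp
  refine ⟨hS.unit, ?_⟩
  rw [hcast, hcast, Units.mul_inv_eq_iff_eq_mul]
  exact h

theorem theorem2p2 {n k : ℕ} (X Y : Matrix (Fin n) (Fin n) ℤ) (a : Fin k → ℤ)
    (ha : Function.Injective a)
    (hX : minpoly ℚ (ratMatrix X) = ∏ i, (Polynomial.X - Polynomial.C (a i : ℚ)))
    (hY : minpoly ℚ (ratMatrix Y) = ∏ i, (Polynomial.X - Polynomial.C (a i : ℚ)))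
    (hass : SmithAssumption X a) :
    ConjugateOver ℤ X Y ↔ ∀ (p : ℕ) [Fact p.Prime], ConjugateOver (zLocal p) X Y := by
  refine ⟨fun h p _ => h.of_int, fun h => ?_⟩
  let P := (∏ i, primDen X a i) * ∏ i, primDen Y a i
  have hP : P ≠ 0 := mul_ne_zero (Finset.prod_ne_zero_iff.mpr fun i _ => primDen_ne_zero X a i)
    (Finset.prod_ne_zero_iff.mpr fun i _ => primDen_ne_zero Y a i)
  -- The factor 2 ensures N > 1 even when all denominators are 1. Then coprimality to N forces det T
  -- ≠ 0, and the lifting modulo N² applies.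
  let N := 2 * P
  have hN : 1 < N := by omega
  obtain ⟨F, hFX, hXF, hF⟩ := exists_integral_multiples_primIdem ha hX (N := N) fun i =>
    ((Finset.dvd_prod_of_mem _ (Finset.mem_univ i)).mul_right _).mul_left 2
  obtain ⟨G, hGY, hYG, hG⟩ := exists_integral_multiples_primIdem ha hY (N := N) fun i =>
    ((Finset.dvd_prod_of_mem _ (Finset.mem_univ i)).mul_left _).mul_left 2
  obtain ⟨T, hT, hdet⟩ := exists_intertwiner_isCoprime_det h (by omega : N ≠ 0)
  have hT0 : T.det ≠ 0 := by
    intro h0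
    rw [h0, isCoprime_zero_left, Int.isUnit_iff] at hdet
    omega
  have hdet2 : IsCoprime T.det ((N ^ 2 : ℕ) : ℤ) := by
    push_cast
    exact hdet.pow_right
  let θ := fun i => (nonempty_eigenLattice_equiv hT hT0 (a i)).some
  -- W inverts the determinants of T on the eigenlattices modulo N². It acts before T, so only the
  -- Smith groups attached to X matter.
  obtain ⟨W, hW, hWdet, hWD⟩ := hass.exists_commuting_det_modEq ha hX fun i =>
    isCoprime_det_comp_eigenMap hT hT0 hdet2 (a i) (θ i)
  have hTW := intertwine_mul hW hT
  obtain ⟨S, hSu, hS⟩ := exists_isUnit_intertwiner hN ha hFX hXF hF hGY hYG hG hTW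
    (by
      rw [Matrix.det_mul]
      refine hdet.mul_left (hWdet.of_isCoprime_of_dvd_right ?_)
      push_cast
      exact dvd_pow_self _ two_ne_zero) θ
    (fun i => by
      rw [eigenMap_mul hW hT, ← LinearMap.comp_assoc, LinearMap.det_comp, mul_comm]
      exact hWD i)
  exact conjugateOver_int_of_isUnit hSu hS
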